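/- Let $\mathcal G=(\mathcal V,\mathcal E,A)$ be a weighted digraph on a finite nonempty node set $\mathcal V$, without self-loops, where $A=[a_{ij}]$ is a nonnegative real matrix with $a_{ij}>0$ if and only if $(j,i)\in\mathcal E$ (that is, there is an edge from $j$ to $i$). Its Laplacian $L=[l_{ij}]$ is given by $l_{ii}=\sum_{j:(j,i)\in\mathcal E}a_{ij}$, $l_{ij}=-a_{ij}$ if $(j,i)\in\mathcal E$, and $l_{ij}=0$ otherwise; consider the network $\dot x=-Lx$ on $[0,\infty)$. A set $\mathcal S\subseteq\mathcal V$ is a topological cluster if it is inclusion-maximal among the sets of nodes with the following property: for every choice of positive weights on the edges $\mathcal E$ and every initial value $x(0)$, the states $x_i(t)$ of all nodes $i$ of the set converge, as $t\to\infty$, to a common value (which may depend on the weights and on $x(0)$). Let $\mathcal G[\mathcal S]$ denote the subgraph induced by $\mathcal S$. A directed spanning tree of $\mathcal G[\mathcal S]$ is a subgraph with node set $\mathcal S$ in which one node, the root, has no parent, every other node has exactly one parent, and every node is reachable from the root; a root node of $\mathcal G[\mathcal S]$ is the root of some directed spanning tree of $\mathcal G[\mathcal S]$. Theorem. A set $\mathcal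 S\subseteq\mathcal V$ is a topological cluster if and only if $\mathcal S$ is inclusion-maximal among the subsets of $\mathcal V$ that satisfy both of the following conditions: (C1) the induced subgraph $\mathcal G[\mathcal S]$ has at least one directed spanning tree; (C2) either no node of $\mathcal S$ has an incoming edge from $\mathcal V\setminus\mathcal S$, or exactly one node of $\mathcal S$ has incoming edges from $\mathcal V\setminus\mathcal S$ and this node is a root node of $\mathcal G[\mathcal S]$. -/

import Mathlib

open Filter Topology

/-- The subgraph of a digraph induced by a set `S` of nodes. -/
def inducedDigraph {V : Type*} (D : Digraph V) (S : Set V) : Digraph S :=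
  ⟨fun u v => D.Adj u v⟩

/-- `T` is a directed tree with root `r`: the root has no parent, every other node has exactly
one parent, and every node can be reached from the root along edges. -/
def IsDirectedTree {W : Type*} (T : Digraph W) (r : W) : Prop :=
  (∀ u, ¬ T.Adj u r) ∧
  (∀ v, v ≠ r → ∃! u, T.Adj u v) ∧
  (∀ v, Relation.ReflTransGen T.Adj r v)

/-- `r` is a root node of `D`: the root of some directed spanning tree of `D`
(`T ≤ D` says that every edge of `T` is an edge of `D`; the node sets coincide). -/
def IsRootNode {W : Type*} (D : Digraph W) (r : W) : Prop :=
  ∃ T : Digraph W, T ≤ D ∧ IsDirectedTree T r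

/-- `D` has at least one directed spanning tree. -/
def HasSpanningTree {W : Type*} (D : Digraph W) : Prop :=
  ∃ r, IsRootNode D r

/-- A weighted digraph without self-loops. `Adj i j` says that `(i, j)` is an edge (from `i`
to `j`), and `weight i j` is the weight `a_ij` of the edge `(j, i)`. -/
structure WeightedDigraph (V : Type*) extends Digraph V where
  loopless : ∀ i, ¬ Adj i i
  weight : Matrix V V ℝ
  weight_nonneg : ∀ i j, 0 ≤ weight i j
  weight_pos_iff : ∀ i j, 0 < weight i j ↔ Adj j i

namespace WeightedDigraph

variable {V : Type*}

open Classical in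
/-- The Laplacian matrix of a weighted digraph. -/
noncomputable def laplacian [Fintype V] (G : WeightedDigraph V) : Matrix V V ℝ :=
  Matrix.of fun i j =>
    if i = j then ∑ k with G.Adj k i, G.weight i k
    else if G.Adj j i then -G.weight i j
    else 0

/-- `x` solves `ẋ = -L x` on `[0, ∞)`, with an arbitrary initial value. -/
def IsTrajectory [Fintype V] (G : WeightedDigraph V) (x : ℝ → V → ℝ) : Prop :=
  ∀ t, 0 ≤ t → HasDerivWithinAt x (-(G.laplacian.mulVec (x t))) (Set.Ici 0) t

/-- The nodes of `S` converge to an identical value independently of the edge weights: for all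
positive weights on the edges of `G` and all initial values, the states of the nodes of `S`
converge to a common value (which may depend on the weights and on the initial values). -/
def ConvergesIdentically [Fintype V] (G : WeightedDigraph V) (S : Set V) : Prop :=
  ∀ H : WeightedDigraph V, H.toDigraph = G.toDigraph →
    ∀ x : ℝ → V → ℝ, H.IsTrajectory x →
      ∃ c : ℝ, ∀ i ∈ S, Tendsto (fun t => x t i) atTop (𝓝 c)

/-- A topological cluster is an inclusion-maximal set of nodes that converge to an identical
value independently of the edge weights. -/
def IsTopologicalCluster [Fintype V] (G : WeightedDigraph V) (S : Set V) : Prop :=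
  Maximal G.ConvergesIdentically S

/-- The nodes of `S` that have an incoming edge from outside `S`. -/
def entryNodes (G : WeightedDigraph V) (S : Set V) : Set V :=
  {i | i ∈ S ∧ ∃ j, j ∉ S ∧ G.Adj j i}

/-- The induced subgraph has at least one directed spanning tree. -/
def CondC1 (G : WeightedDigraph V) (S : Set V) : Prop :=
  HasSpanningTree (inducedDigraph G.toDigraph S)

/-- Either no node of `S` has an incoming edge from outside `S`, or exactly one node of `S` has
one and this node is a root node of the induced subgraph. -/
def CondC2 (G : WeightedDigraph V) (S : Set V) : Prop :=
  G.entryNodes S = ∅ ∨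
  ∃ r : S, IsRootNode (inducedDigraph G.toDigraph S) r ∧ G.entryNodes S = {(r : V)}

end WeightedDigraph

/-! For fixed weights, `-L` has 0 as a semisimple eigenvalue and its other eigenvalues lie in the
open left half plane, so every trajectory converges to an equilibrium. The question is thus which
nodes agree in every equilibrium, for every choice of weights.

C1 and C2 together amount to `HasGate`: one node reaches the whole set inside it, and no other node
of the set is fed from outside. By the maximum principle, an equilibrium is constant on such a set:
its extrema over the set propagate backwards along edges to the gate. This is sufficiency.

Conversely, `h` is an equilibrium for some weights as soon as each node either agrees with all its
predecessors or lies strictly between two of them (`IsBalanced`). A level set without a gate can be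
split by a small balanced perturbation, so a balanced `h` that separates as many pairs as possible
has only gated level sets. Identical convergence forces a set into one of them. Thus gated sets
converge identically and every identically converging set lies in a gated one, so both properties
have the same maximal sets. -/

/-! ### Convergence of linear flows with a semisimple zero eigenvalue -/

section LinearFlow

open Polynomial

/-- `y` solves `ẏ = -f y` on `[0, ∞)`. -/
def IsLinearFlow {E : Type*} [NormedAddCommGroup E] [NormedSpace ℂ E] (f : Module.End ℂ E)
    (y : ℝ → E) : Prop :=
  ∀ t, 0 ≤ t → HasDerivWithinAt y (-(f (y t))) (Set.Ici 0) t

variable {E : Type*} [NormedAddCommGroup E] [NormedSpace ℂ E]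

/-- The integrating factor `exp (μ t)` removes the linear term. Once `‖g‖ < μ.re * (ε / 2)`, the
forcing contributes at most `ε / 2` to `‖w‖`, and the rest decays exponentially. -/
theorem tendsto_zero_of_hasDerivWithinAt {μ : ℂ} (hμ : 0 < μ.re) {w g : ℝ → E}
    (hw : ∀ t, 0 ≤ t → HasDerivWithinAt w (-(μ • w t) - g t) (Set.Ici 0) t)
    (hg : Tendsto g atTop (𝓝 0)) : Tendsto w atTop (𝓝 0) := by
  rw [Metric.tendsto_atTop]
  intro ε hε
  obtain ⟨T₀, hT₀⟩ := (Metric.tendsto_atTop.1 hg) (μ.re * (ε / 2)) (by positivity)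
  set T := max T₀ 0 with hT
  have hT0 : 0 ≤ T := le_max_right _ _
  have hexp : ∀ t : ℝ, HasDerivAt (fun t : ℝ => Complex.exp (μ * t)) (Complex.exp (μ * t) * μ) t := by
    intro t
    have h1 : HasDerivAt (fun t : ℝ => μ * (t : ℂ)) (μ * 1) t :=
      (Complex.ofRealCLM.hasDerivAt (x := t)).const_mul μ
    simpa using h1.cexp
  have hnorm : ∀ t : ℝ, ‖Complex.exp (μ * t)‖ = Real.exp (μ.re * t) := by
    intro t; rw [Complex.norm_exp]; simp
  have hu : ∀ t : ℝ, 0 ≤ t → HasDerivWithinAt (fun t : ℝ => Complex.exp (μ * t) • w t)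
      (-(Complex.exp (μ * t) • g t)) (Set.Ici 0) t := by
    intro t ht
    refine ((hexp t).hasDerivWithinAt.smul (hw t ht)).congr_deriv ?_
    rw [smul_sub, smul_neg, mul_smul]
    abel
  have hbound : ∀ t, T ≤ t → ‖w t‖ ≤
      ε / 2 + Real.exp (-(μ.re * t)) * (Real.exp (μ.re * T) * ‖w T‖) := by
    intro t ht
    have key := image_norm_le_of_norm_deriv_right_le_deriv_boundary
      (f := fun t : ℝ => Complex.exp (μ * t) • w t) (f' := fun t => -(Complex.exp (μ * t) • g t))
      (a := T) (b := t)
      (B := fun t => Real.exp (μ.re * T) * ‖w T‖ + (ε / 2) * (Real.exp (μ.re * t)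
        - Real.exp (μ.re * T)))
      (B' := fun t => (ε / 2) * (Real.exp (μ.re * t) * μ.re))
      (fun s hs => ((hu s (hT0.trans hs.1)).continuousWithinAt).mono
        fun z hz => hT0.trans hz.1)
      (fun s hs => (hu s (hT0.trans hs.1)).mono fun z hz => (hT0.trans hs.1).trans hz)
      (by simp [norm_smul, hnorm])
      (by
        intro s
        have h1 : HasDerivAt (fun s : ℝ => μ.re * s) μ.re s := by
          simpa using (hasDerivAt_id s).const_mul μ.re
        exact ((h1.exp.sub_const _).const_mul _).const_add _)
      (by
        intro s hs
        rw [norm_neg, norm_smul, hnorm]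
        have h2 : ‖g s‖ < μ.re * (ε / 2) := by
          simpa using hT₀ s ((le_max_left _ _).trans hs.1)
        have h3 := Real.exp_pos (μ.re * s)
        nlinarith)
      (Set.right_mem_Icc.2 ht)
    simp only [norm_smul, hnorm] at key
    have h3 := Real.exp_pos (μ.re * t)
    have h4 := Real.exp_pos (μ.re * T)
    have h5 : Real.exp (-(μ.re * t)) * Real.exp (μ.re * t) = 1 := by
      rw [← Real.exp_add]; simp
    have h6 : Real.exp (-(μ.re * t)) * (Real.exp (μ.re * t) * ‖w t‖) ≤
        Real.exp (-(μ.re * t)) * (Real.exp (μ.re * T) * ‖w T‖ + (ε / 2) * Real.exp (μ.re * t)) := by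
      gcongr
      nlinarith
    calc ‖w t‖ = Real.exp (-(μ.re * t)) * (Real.exp (μ.re * t) * ‖w t‖) := by
          rw [← mul_assoc, h5, one_mul]
      _ ≤ _ := h6
      _ = _ := by linear_combination (ε / 2) * h5
  have hlim : Tendsto (fun t : ℝ => Real.exp (-(μ.re * t)) * (Real.exp (μ.re * T) * ‖w T‖))
      atTop (𝓝 0) := by
    have h1 : Tendsto (fun t : ℝ => Real.exp (-(μ.re * t))) atTop (𝓝 0) :=
      Real.tendsto_exp_neg_atTop_nhds_zero.comp (tendsto_id.const_mul_atTop hμ)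
    simpa using h1.mul_const (Real.exp (μ.re * T) * ‖w T‖)
  obtain ⟨T₁, hT₁⟩ := eventually_atTop.1 (hlim.eventually (gt_mem_nhds (half_pos hε)))
  refine ⟨max T T₁, fun t ht => ?_⟩
  rw [dist_zero_right]
  have h1 := hbound t ((le_max_left _ _).trans ht)
  have h2 := hT₁ t ((le_max_right _ _).trans ht)
  linarith

theorem tendsto_of_hasDerivWithinAt {μ : ℂ} (hμ : 0 < μ.re) {w g : ℝ → E} {l : E}
    (hw : ∀ t, 0 ≤ t → HasDerivWithinAt w (-(μ • w t) - g t) (Set.Ici 0) t)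
    (hg : Tendsto g atTop (𝓝 l)) : Tendsto w atTop (𝓝 (-(μ⁻¹ • l))) := by
  have hμ0 : μ ≠ 0 := by rintro rfl; simp at hμ
  have h1 : Tendsto (fun t => w t + μ⁻¹ • l) atTop (𝓝 0) := by
    refine tendsto_zero_of_hasDerivWithinAt hμ (g := fun t => g t - l) (fun t ht => ?_) ?_
    · convert (hw t ht).add_const (μ⁻¹ • l) using 1
      rw [smul_add, smul_smul, mul_inv_cancel₀ hμ0, one_smul]
      abel
    · simpa using hg.sub_const l
  simpa using h1.sub_const (μ⁻¹ • l)

theorem commute_aeval (f : Module.End ℂ E) (p : ℂ[X]) : Commute f (aeval f p) := by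
  have := Commute.all (X : ℂ[X]) p
  simpa using this.map (aeval f)

variable [FiniteDimensional ℂ E]

theorem IsLinearFlow.map {f : Module.End ℂ E} {y : ℝ → E} (hy : IsLinearFlow f y)
    {g : Module.End ℂ E} (hg : Commute f g) : IsLinearFlow f (fun t => g (y t)) := by
  intro t ht
  have h := (((LinearMap.toContinuousLinearMap g).restrictScalars ℝ).hasFDerivAt
    (x := y t)).comp_hasDerivWithinAt t (hy t ht)
  have h1 : f (g (y t)) = g (f (y t)) := LinearMap.congr_fun hg.eq (y t)
  refine h.congr_deriv ?_
  simp [h1]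

/-- Factors are peeled off one at a time: `z' = -a z - (f - a) z`, so convergence of `(f - a) z`
gives convergence of `z` when `0 < a.re`. -/
theorem IsLinearFlow.tendsto_of_tendsto_prod {f : Module.End ℂ E} (s : Multiset ℂ)
    (hs : ∀ μ ∈ s, 0 < μ.re) {y : ℝ → E} (hy : IsLinearFlow f y) {l : E}
    (hl : Tendsto (fun t => aeval f (s.map (fun a => X - C a)).prod (y t)) atTop (𝓝 l)) :
    ∃ l', Tendsto y atTop (𝓝 l') ∧ (l = 0 → l' = 0) := by
  induction s using Multiset.induction_on generalizing l with
  | empty => exact ⟨l, by simpa using hl, id⟩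
  | cons a s ih =>
    set z : ℝ → E := fun t => aeval f (s.map (fun a => X - C a)).prod (y t) with hz
    have hzf : IsLinearFlow f z := hy.map (commute_aeval f _)
    have hl' : Tendsto (fun t => f (z t) - a • z t) atTop (𝓝 l) := by
      refine hl.congr fun t => ?_
      simp [hz, sub_mul]
    have h1 : Tendsto z atTop (𝓝 (-(a⁻¹ • l))) := by
      refine tendsto_of_hasDerivWithinAt (hs a (Multiset.mem_cons_self a s)) (fun t ht => ?_) hl'
      convert hzf t ht using 1
      abel
    obtain ⟨l', h2, h3⟩ := ih (fun μ hμ => hs μ (Multiset.mem_cons_of_mem hμ)) h1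
    exact ⟨l', h2, fun h => h3 (by simp [h])⟩

/-- If zero is a semisimple eigenvalue of `f` and the other eigenvalues have positive real part,
then the solutions of `ẏ = -f y` converge to equilibria. -/
theorem IsLinearFlow.exists_tendsto {f : Module.End ℂ E}
    (hf : ∀ μ, f.HasEigenvalue μ → μ = 0 ∨ 0 < μ.re) (hker : ∀ v, f (f v) = 0 → f v = 0)
    {y : ℝ → E} (hy : IsLinearFlow f y) : ∃ l, Tendsto y atTop (𝓝 l) ∧ f l = 0 := by
  classical
  set s := (minpoly ℂ f).roots.filter (fun μ => ¬ μ = 0) with hs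
  have hspos : ∀ μ ∈ s, 0 < μ.re := by
    intro μ hμ
    rw [hs, Multiset.mem_filter] at hμ
    exact (hf μ (Module.End.hasEigenvalue_iff_isRoot.2 (isRoot_of_mem_roots hμ.1))).resolve_left
      hμ.2
  set q := (s.map (fun a => X - C a)).prod with hq
  obtain ⟨m, hm⟩ : ∃ m, minpoly ℂ f = X ^ m * q := by
    refine ⟨(minpoly ℂ f).roots.count 0, ?_⟩
    conv_lhs => rw [(IsAlgClosed.splits (minpoly ℂ f)).eq_prod_roots_of_monic
      (minpoly.monic (Algebra.IsIntegral.isIntegral f)),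
      ← Multiset.filter_add_not (fun μ => μ = 0) (minpoly ℂ f).roots]
    rw [Multiset.map_add, Multiset.prod_add, Multiset.filter_eq']
    simp [hq, hs]
  -- Semisimplicity lowers the power `X ^ m` in the minimal polynomial to `X`. Hence `q(f) y` is
  -- constant along the flow, and `q(f)` vanishes on the range of `f`.
  have hkill : ∀ v, f (aeval f q v) = 0 := by
    have hpow : ∀ m v, (f ^ m) v = 0 → f v = 0 := by
      intro m
      induction m with
      | zero => intro v hv; simp at hv; simp [hv]
      | succ m ih =>
        intro v hv
        rw [pow_succ, Module.End.mul_apply] at hv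
        exact hker v (ih _ hv)
    intro v
    refine hpow m _ ?_
    have h := minpoly.aeval ℂ f
    rw [hm] at h
    simpa using LinearMap.congr_fun h v
  have hcomm : ∀ v, aeval f q (f v) = 0 := fun v => by
    rw [← hkill v]
    exact (LinearMap.congr_fun (commute_aeval f q).eq v).symm
  have hconst : ∀ t, 0 ≤ t → aeval f q (y t) = aeval f q (y 0) := by
    intro t ht
    have hz := hy.map (commute_aeval f q)
    refine constant_of_has_deriv_right_zero (a := 0) (b := t)
      (f := fun t => aeval f q (y t)) ?_ ?_ t (Set.right_mem_Icc.2 ht)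
    · exact fun s hs => ((hz s hs.1).continuousWithinAt).mono fun z hz => hz.1
    · intro s hs
      have := (hz s hs.1).mono (s := Set.Ici s) fun z hz => Set.mem_Ici.2 (hs.1.trans (Set.mem_Ici.1 hz))
      simpa [hkill] using this
  obtain ⟨l, hl, -⟩ := hy.tendsto_of_tendsto_prod s hspos
    (l := aeval f q (y 0)) (tendsto_const_nhds.congr' (by
      filter_upwards [eventually_ge_atTop 0] with t ht using (hconst t ht).symm))
  -- `f ∘ y` is itself a flow annihilated by `q(f)`, so it tends to 0 and the limit of `y` is an
  -- equilibrium.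
  obtain ⟨l', hl', h0⟩ := (hy.map (Commute.refl f)).tendsto_of_tendsto_prod s hspos (l := 0)
    (tendsto_const_nhds.congr fun t => (hcomm (y t)).symm)
  refine ⟨l, hl, ?_⟩
  have h2 : Tendsto (fun t => f (y t)) atTop (𝓝 (f l)) :=
    ((LinearMap.toContinuousLinearMap f).continuous.tendsto l).comp hl
  rw [tendsto_nhds_unique h2 hl', h0 rfl]

end LinearFlow

/-! ### Spectrum of the Laplacian and convergence of trajectories -/

namespace WeightedDigraph

variable {V : Type*}

theorem weight_eq_zero (G : WeightedDigraph V) {i j : V} (h : ¬ G.Adj j i) : G.weight i j = 0 :=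
  le_antisymm (not_lt.1 fun h' => h ((G.weight_pos_iff i j).1 h')) (G.weight_nonneg i j)

variable [Fintype V]

theorem laplacian_apply_self (G : WeightedDigraph V) (i : V) :
    G.laplacian i i = ∑ k, G.weight i k := by
  classical
  simp only [laplacian, Matrix.of_apply, if_true]
  rw [Finset.sum_filter]
  refine Finset.sum_congr rfl fun k _ => ?_
  split_ifs with h
  · rfl
  · exact (G.weight_eq_zero h).symm

theorem laplacian_apply_of_ne (G : WeightedDigraph V) {i j : V} (hij : i ≠ j) :
    G.laplacian i j = -G.weight i j := by
  simp only [laplacian, Matrix.of_apply, if_neg hij]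
  split_ifs with h
  · rfl
  · rw [G.weight_eq_zero h, neg_zero]

theorem laplacian_mulVec_apply (G : WeightedDigraph V) (x : V → ℝ) (i : V) :
    G.laplacian.mulVec x i = ∑ k, G.weight i k * (x i - x k) := by
  classical
  have h : ∀ k, G.laplacian i k * x k =
      (if k = i then (∑ j, G.weight i j) * x i else 0) - G.weight i k * x k := by
    intro k
    by_cases hk : k = i
    · subst hk
      rw [laplacian_apply_self, if_pos rfl, G.weight_eq_zero (G.loopless k)]
      ring
    · rw [G.laplacian_apply_of_ne (Ne.symm hk), if_neg hk]
      ring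
  rw [Matrix.mulVec, dotProduct, Finset.sum_congr rfl fun k _ => h k, Finset.sum_sub_distrib,
    Finset.sum_ite_eq' Finset.univ i, if_pos (Finset.mem_univ i), Finset.sum_mul,
    ← Finset.sum_sub_distrib]
  exact Finset.sum_congr rfl fun k _ => by ring

/-- At a node where the Laplacian vanishes, a local maximum over the in-neighbours is attained at
each in-neighbour. -/
theorem eq_of_laplacian_eq_zero_of_le (G : WeightedDigraph V) {x : V → ℝ} {i : V}
    (h0 : G.laplacian.mulVec x i = 0) (hle : ∀ j, G.Adj j i → x j ≤ x i) {j : V}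
    (hj : G.Adj j i) : x j = x i := by
  rw [laplacian_mulVec_apply] at h0
  have hnn : ∀ k ∈ Finset.univ, 0 ≤ G.weight i k * (x i - x k) := by
    intro k _
    by_cases hk : G.Adj k i
    · exact mul_nonneg (G.weight_nonneg i k) (sub_nonneg.2 (hle k hk))
    · rw [G.weight_eq_zero hk, zero_mul]
  have := (Finset.sum_eq_zero_iff_of_nonneg hnn).1 h0 j (Finset.mem_univ j)
  rcases mul_eq_zero.1 this with h | h
  · exact absurd h ((G.weight_pos_iff i j).2 hj).ne'
  · linarith

theorem laplacian_mulVec_neg (G : WeightedDigraph V) (x : V → ℝ) :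
    G.laplacian.mulVec (fun i => -x i) = -G.laplacian.mulVec x :=
  Matrix.mulVec_neg _ _

/-- Half of the semisimplicity of the eigenvalue 0. With `w = L x` and `L w = 0`, the set where `w`
is maximal is closed under predecessors. At a node of this set where `x` is least, `L x ≤ 0`, so the
maximum of `w` is nonpositive. -/
theorem laplacian_mulVec_nonpos (G : WeightedDigraph V) {x : V → ℝ}
    (h : G.laplacian.mulVec (G.laplacian.mulVec x) = 0) (i : V) : G.laplacian.mulVec x i ≤ 0 := by
  classical
  set w := G.laplacian.mulVec x with hw
  by_contra! hi
  obtain ⟨m, -, hm⟩ := Finset.exists_max_image Finset.univ w ⟨i, Finset.mem_univ i⟩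
  have hm' : ∀ k, w k ≤ w m := fun k => hm k (Finset.mem_univ k)
  obtain ⟨n, hn, hmin⟩ := Finset.exists_min_image (Finset.univ.filter fun k => w k = w m) x
    ⟨m, by simp⟩
  simp only [Finset.mem_filter, Finset.mem_univ, true_and] at hn hmin
  have h1 : w n ≤ 0 := by
    rw [hw, laplacian_mulVec_apply]
    refine Finset.sum_nonpos fun k _ => ?_
    by_cases hk : G.Adj k n
    · have hkw : w k = w n := G.eq_of_laplacian_eq_zero_of_le (congr_fun h n)
        (fun j _ => hn ▸ hm' j) hk
      exact mul_nonpos_of_nonneg_of_nonpos (G.weight_nonneg n k)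
        (sub_nonpos.2 (hmin k (hkw.trans hn)))
    · rw [G.weight_eq_zero hk, zero_mul]
  linarith [hm' i]

theorem laplacian_mulVec_eq_zero (G : WeightedDigraph V) {x : V → ℝ}
    (h : G.laplacian.mulVec (G.laplacian.mulVec x) = 0) : G.laplacian.mulVec x = 0 := by
  funext i
  refine le_antisymm (G.laplacian_mulVec_nonpos h i) ?_
  have h1 : G.laplacian.mulVec (G.laplacian.mulVec (-x)) = 0 := by
    simp [Matrix.mulVec_neg, h]
  have := G.laplacian_mulVec_nonpos h1 i
  simpa [Matrix.mulVec_neg] using this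

open Classical in
/-- The Laplacian as an endomorphism of the complex state space. -/
noncomputable def complexLaplacian (G : WeightedDigraph V) : Module.End ℂ (V → ℂ) :=
  Matrix.toLin' (G.laplacian.map (fun a : ℝ => (a : ℂ)))

theorem re_complexLaplacian (G : WeightedDigraph V) (v : V → ℂ) (i : V) :
    (G.complexLaplacian v i).re = G.laplacian.mulVec (fun k => (v k).re) i := by
  simp [complexLaplacian, Matrix.mulVec, dotProduct]

theorem im_complexLaplacian (G : WeightedDigraph V) (v : V → ℂ) (i : V) :
    (G.complexLaplacian v i).im = G.laplacian.mulVec (fun k => (v k).im) i := by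
  simp [complexLaplacian, Matrix.mulVec, dotProduct]

theorem complexLaplacian_eq_zero (G : WeightedDigraph V) (v : V → ℂ)
    (h : G.complexLaplacian (G.complexLaplacian v) = 0) : G.complexLaplacian v = 0 := by
  funext i
  apply Complex.ext
  · rw [re_complexLaplacian]
    refine congr_fun (G.laplacian_mulVec_eq_zero (funext fun j => ?_)) i
    have := re_complexLaplacian G (G.complexLaplacian v) j
    rw [h] at this
    simpa [funext (re_complexLaplacian G v)] using this.symm
  · rw [im_complexLaplacian]
    refine congr_fun (G.laplacian_mulVec_eq_zero (funext fun j => ?_)) i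
    have := im_complexLaplacian G (G.complexLaplacian v) j
    rw [h] at this
    simpa [funext (im_complexLaplacian G v)] using this.symm

/-- Gershgorin: zero row sums make each disc have its centre `d ≥ 0` equal to its radius, so it
meets the closed left half plane only at 0. -/
theorem eigenvalue_complexLaplacian (G : WeightedDigraph V) (μ : ℂ)
    (h : G.complexLaplacian.HasEigenvalue μ) : μ = 0 ∨ 0 < μ.re := by
  classical
  obtain ⟨k, hk⟩ := eigenvalue_mem_ball (A := G.laplacian.map (fun a : ℝ => (a : ℂ))) (μ := μ)
    h
  have hrow : ∑ j ∈ Finset.univ.erase k, ‖G.laplacian.map (fun a : ℝ => (a : ℂ)) k j‖ =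
      G.laplacian k k := by
    rw [laplacian_apply_self, ← Finset.sum_erase (a := k) Finset.univ
      (G.weight_eq_zero (G.loopless k))]
    refine Finset.sum_congr rfl fun j hj => ?_
    rw [Matrix.map_apply, G.laplacian_apply_of_ne (Finset.ne_of_mem_erase hj).symm]
    simp [abs_of_nonneg (G.weight_nonneg k j)]
  rw [hrow, Metric.mem_closedBall, dist_eq_norm, Matrix.map_apply] at hk
  set d := G.laplacian k k
  have hd : 0 ≤ d := (norm_nonneg _).trans hk
  have h2 : (μ.re - d) ^ 2 + μ.im ^ 2 ≤ d ^ 2 := by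
    have h3 : ‖μ - d‖ ^ 2 ≤ d ^ 2 := by gcongr
    rw [Complex.sq_norm, Complex.normSq_apply] at h3
    simp at h3
    nlinarith
  by_cases hre : 0 < μ.re
  · exact Or.inr hre
  · left
    have h4 : μ.re ^ 2 + μ.im ^ 2 ≤ 0 := by nlinarith
    apply Complex.ext
    · simp; nlinarith [sq_nonneg μ.re, sq_nonneg μ.im]
    · simp; nlinarith [sq_nonneg μ.re, sq_nonneg μ.im]

/-- Every trajectory converges to an equilibrium. -/
theorem IsTrajectory.exists_tendsto {G : WeightedDigraph V} {x : ℝ → V → ℝ}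
    (hx : G.IsTrajectory x) :
    ∃ l : V → ℝ, (∀ i, Tendsto (fun t => x t i) atTop (𝓝 (l i))) ∧ G.laplacian.mulVec l = 0 := by
  have hflow : IsLinearFlow G.complexLaplacian (fun t i => (x t i : ℂ)) := by
    intro t ht
    rw [hasDerivWithinAt_pi]
    intro i
    refine ((hasDerivWithinAt_pi.1 (hx t ht)) i).ofReal_comp.congr_deriv ?_
    apply Complex.ext
    · simp [re_complexLaplacian]
    · simp only [Pi.neg_apply, Complex.neg_im, im_complexLaplacian]
      simp [Matrix.mulVec, dotProduct]
  obtain ⟨l, hl, h0⟩ := hflow.exists_tendsto G.eigenvalue_complexLaplacian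
    G.complexLaplacian_eq_zero
  refine ⟨fun i => (l i).re, fun i => ?_, ?_⟩
  · have := (Complex.continuous_re.tendsto (l i)).comp ((tendsto_pi_nhds.1 hl) i)
    simpa [Function.comp_def] using this
  · funext i
    rw [← re_complexLaplacian, h0]
    simp

/-- An equilibrium is a constant trajectory. -/
theorem isTrajectory_const {G : WeightedDigraph V} {l : V → ℝ} (hl : G.laplacian.mulVec l = 0) :
    G.IsTrajectory fun _ => l := by
  intro t _
  simpa [hl] using hasDerivWithinAt_const t (Set.Ici 0) l

end WeightedDigraph

/-! ### Root nodes and reachability -/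

section Reachability

variable {W : Type*}

/-- A node is a root node if and only if every node is reachable from it. -/
theorem isRootNode_iff (D : Digraph W) (r : W) :
    IsRootNode D r ↔ ∀ v, Relation.ReflTransGen D.Adj r v := by
  refine ⟨fun ⟨T, hT, _, _, h⟩ v => (h v).lift id fun _ _ hab => hT hab, fun h => ?_⟩
  -- `B n` collects the ends of walks of length `n` from `r`. A breadth-first tree results from
  -- giving each node a parent at smaller distance.
  let B : ℕ → Set W := fun n => Nat.rec {r} (fun _ S => {v | ∃ u ∈ S, D.Adj u v}) n
  have hex : ∀ v, ∃ n, v ∈ B n := by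
    intro v
    induction h v with
    | refl => exact ⟨0, rfl⟩
    | tail _ hbc ih =>
      obtain ⟨n, hn⟩ := ih
      exact ⟨n + 1, _, hn, hbc⟩
  let d : W → ℕ := fun v => sInf {n | v ∈ B n}
  have hstep : ∀ v, ∃ u, v ≠ r → D.Adj u v ∧ d u < d v := by
    intro v
    by_cases hv : v = r
    · exact ⟨v, fun h => absurd hv h⟩
    · have hd : v ∈ B (d v) := Nat.sInf_mem (hex v)
      rcases hn : d v with _ | n
      · rw [hn] at hd
        exact absurd hd hv
      · rw [hn] at hd
        obtain ⟨u, hu, huv⟩ := hd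
        exact ⟨u, fun _ => ⟨huv, Nat.lt_succ_of_le (Nat.sInf_le hu)⟩⟩
  choose p hp using hstep
  refine ⟨⟨fun u v => v ≠ r ∧ u = p v⟩, ?_, fun u hu => hu.1 rfl,
    fun v hv => ⟨p v, ⟨hv, rfl⟩, fun u hu => hu.2⟩, ?_⟩
  · rintro u v ⟨hv, rfl⟩
    exact (hp v hv).1
  · intro v
    induction hn : d v using Nat.strong_induction_on generalizing v with
    | _ n ih =>
      by_cases hv : v = r
      · rw [hv]
      · exact (ih (d (p v)) (hn ▸ (hp v hv).2) (p v) rfl).tail ⟨hv, rfl⟩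

/-- If any two nonempty sets closed under predecessors meet, then some node reaches all nodes. -/
theorem exists_forall_reflTransGen [Finite W] [Nonempty W] (E : W → W → Prop)
    (hE : ∀ A B : Set W, A.Nonempty → B.Nonempty → (∀ i ∈ A, ∀ j, E j i → j ∈ A) →
      (∀ i ∈ B, ∀ j, E j i → j ∈ B) → ¬ Disjoint A B) :
    ∃ r, ∀ v, Relation.ReflTransGen E r v := by
  let anc : W → Set W := fun w => {u | Relation.ReflTransGen E u w}
  have hclosed : ∀ w, ∀ i ∈ anc w, ∀ j, E j i → j ∈ anc w :=
    fun w i hi j hj => Relation.ReflTransGen.head hj hi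
  have hself : ∀ w, w ∈ anc w := fun w => Relation.ReflTransGen.refl
  -- A node with a minimal ancestor set works: a common ancestor `z` of `r` and `v` has the same
  -- ancestors as `r`, so `r` reaches `z`, hence `v`.
  obtain ⟨_, ⟨r, rfl⟩, hr⟩ := (Set.toFinite (Set.range anc)).exists_minimal
    (Set.range_nonempty anc)
  refine ⟨r, fun v => ?_⟩
  obtain ⟨z, hzr, hzv⟩ := Set.not_disjoint_iff.1
    (hE (anc r) (anc v) ⟨r, hself r⟩ ⟨v, hself v⟩ (hclosed r) (hclosed v))
  have hsub : anc z ⊆ anc r := fun u hu => Relation.ReflTransGen.trans hu hzr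
  exact Relation.ReflTransGen.trans (hr ⟨z, rfl⟩ hsub (hself r)) hzv

end Reachability

/-! ### Balanced functions -/

section Balanced

/-- At each node, `h` is either equal to its value at all predecessors, or strictly between its
values at two predecessors. -/
def IsBalanced {W : Type*} (E : W → W → Prop) (h : W → ℝ) : Prop :=
  ∀ i, (∀ j, E j i → h j = h i) ∨ (∃ j, E j i ∧ h j < h i) ∧ ∃ j, E j i ∧ h i < h j

/-- Two disjoint sets closed under predecessors are separated by a balanced function. -/
theorem exists_isBalanced_of_disjoint {W : Type*} [Fintype W] (E : W → W → Prop) {A B : Set W}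
    (hA : ∀ i ∈ A, ∀ j, E j i → j ∈ A) (hB : ∀ i ∈ B, ∀ j, E j i → j ∈ B) (hAB : Disjoint A B) :
    ∃ g : W → ℝ, IsBalanced E g ∧ (∀ i ∈ A, g i = 1) ∧ ∀ i ∈ B, g i = 0 := by
  classical
  let avg : (W → Set.Icc (0 : ℝ) 1) → W → ℝ := fun g i =>
    (∑ j with E j i, (g j : ℝ)) / (Finset.univ.filter fun j => E j i).card
  have havg : ∀ g i, avg g i ∈ Set.Icc (0 : ℝ) 1 := by
    refine fun g i => ⟨div_nonneg (Finset.sum_nonneg fun j _ => (g j).2.1) (Nat.cast_nonneg _),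
      div_le_one_of_le₀ ?_ (Nat.cast_nonneg _)⟩
    simpa using Finset.sum_le_card_nsmul (Finset.univ.filter fun j => E j i)
      (fun j => (g j : ℝ)) 1 fun j _ => (g j).2.2
  -- Averaging over predecessors with boundary values 1 on `A` and 0 on `B` is monotone on a
  -- complete lattice, so Knaster–Tarski gives a harmonic function without solving a linear system.
  let F : (W → Set.Icc (0 : ℝ) 1) →o (W → Set.Icc (0 : ℝ) 1) :=
    { toFun := fun g i => if i ∈ A then ⟨1, by simp⟩ else if i ∈ B then ⟨0, by simp⟩ else
        ⟨avg g i, havg g i⟩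
      monotone' := by
        intro g g' hg i
        dsimp only
        split_ifs
        · exact le_rfl
        · exact le_rfl
        · refine Subtype.mk_le_mk.2 ?_
          simp only [avg]
          gcongr with j
          exact hg j }
  obtain ⟨g, hg⟩ : ∃ g, F g = g := ⟨_, F.map_lfp⟩
  have hgA : ∀ i ∈ A, (g i : ℝ) = 1 := by
    intro i hi
    rw [← hg]
    simp [F, hi]
  have hgB : ∀ i ∈ B, (g i : ℝ) = 0 := by
    intro i hi
    have hi' : i ∉ A := fun h => Set.disjoint_left.1 hAB h hi
    rw [← hg]
    simp [F, hi, hi']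
  refine ⟨fun i => g i, fun i => ?_, hgA, hgB⟩
  by_cases hiA : i ∈ A
  · exact Or.inl fun j hj => by simp only [hgA i hiA, hgA j (hA i hiA j hj)]
  by_cases hiB : i ∈ B
  · exact Or.inl fun j hj => by simp only [hgB i hiB, hgB j (hB i hiB j hj)]
  have hgi : (g i : ℝ) = avg g i := by
    conv_lhs => rw [← hg]
    simp [F, hiA, hiB]
  by_cases hne : ∀ j, ¬ E j i
  · exact Or.inl fun j hj => absurd hj (hne j)
  have hsum : ∑ j with E j i, (g j : ℝ) = ∑ j with E j i, (g i : ℝ) := by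
    push Not at hne
    obtain ⟨j, hj⟩ := hne
    have hcard : ((Finset.univ.filter fun j => E j i).card : ℝ) ≠ 0 := by
      exact_mod_cast (Finset.card_pos.2 ⟨j, by simpa using hj⟩).ne'
    rw [Finset.sum_const, nsmul_eq_mul, hgi]
    simp only [avg]
    field_simp
  by_cases hlt : ∃ j, E j i ∧ (g j : ℝ) < g i
  · by_cases hgt : ∃ j, E j i ∧ (g i : ℝ) < g j
    · exact Or.inr ⟨hlt, hgt⟩
    · push Not at hgt
      left
      have := (Finset.sum_eq_sum_iff_of_le (s := Finset.univ.filter fun j => E j i)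
        (f := fun j => (g j : ℝ)) (g := fun _ => (g i : ℝ))
        (by simpa using hgt)).1 hsum
      simpa using this
  · push Not at hlt
    left
    have := (Finset.sum_eq_sum_iff_of_le (s := Finset.univ.filter fun j => E j i)
      (f := fun _ => (g i : ℝ)) (g := fun j => (g j : ℝ))
      (by simpa using hlt)).1 hsum.symm
    exact fun j hj => (this j (by simpa using hj)).symm

end Balanced

/-! ### Gates, choice of weights and refinement of level sets -/

namespace WeightedDigraph

variable {V : Type*}

/-- Some node of `T` reaches all nodes of `T` inside `T`, and it is the only node of `T` that may
have incoming edges from outside `T`. -/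
def HasGate (G : WeightedDigraph V) (T : Set V) : Prop :=
  ∃ r : T, (∀ v : T, Relation.ReflTransGen (inducedDigraph G.toDigraph T).Adj r v) ∧
    ∀ v ∈ T, v ≠ r → ∀ u, G.Adj u v → u ∈ T

theorem condC1_and_condC2_iff (G : WeightedDigraph V) (T : Set V) :
    G.CondC1 T ∧ G.CondC2 T ↔ G.HasGate T := by
  constructor
  · rintro ⟨⟨r₀, h₀⟩, h | ⟨r, hr, h⟩⟩
    · refine ⟨r₀, (isRootNode_iff _ _).1 h₀, fun v hv _ u hu => ?_⟩
      by_contra huT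
      have : v ∈ G.entryNodes T := ⟨hv, u, huT, hu⟩
      simp [h] at this
    · refine ⟨r, (isRootNode_iff _ _).1 hr, fun v hv hvr u hu => ?_⟩
      by_contra huT
      have : v ∈ G.entryNodes T := ⟨hv, u, huT, hu⟩
      rw [h] at this
      exact hvr this
  · rintro ⟨r, hr, hcl⟩
    have hroot := (isRootNode_iff (inducedDigraph G.toDigraph T) r).2 hr
    refine ⟨⟨r, hroot⟩, ?_⟩
    rcases (G.entryNodes T).eq_empty_or_nonempty with h | h
    · exact Or.inl h
    · refine Or.inr ⟨r, hroot, h.subset_singleton_iff.1 ?_⟩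
      rintro v ⟨hv, u, huT, hu⟩
      by_contra hvr
      exact huT (hcl v hv hvr u hu)

/-- Maximum principle: away from `r` all predecessors lie in `T`, so the maximal value passes back
along a path from `r`. -/
theorem HasGate.eq_of_forall_le {G : WeightedDigraph V} {T : Set V} {r : T}
    (hr : ∀ v : T, Relation.ReflTransGen (inducedDigraph G.toDigraph T).Adj r v)
    (hcl : ∀ v ∈ T, v ≠ r → ∀ u, G.Adj u v → u ∈ T) [Fintype V] {l : V → ℝ}
    (hl : G.laplacian.mulVec l = 0) {v : V} (hv : v ∈ T) (hmax : ∀ u ∈ T, l u ≤ l v) :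
    l v = l r := by
  suffices h : ∀ w : T, Relation.ReflTransGen (inducedDigraph G.toDigraph T).Adj r w →
      l w = l v → l r = l v from (h ⟨v, hv⟩ (hr _) rfl).symm
  intro w hw
  induction hw with
  | refl => exact id
  | @tail b c _ hbc ih =>
    intro hc
    by_cases hcr : c = r
    · rw [← hcr, hc]
    · refine ih ?_
      rw [← hc]
      refine G.eq_of_laplacian_eq_zero_of_le (congr_fun hl c) (fun j hj => ?_) hbc
      rw [hc]
      exact hmax j (hcl c c.2 (fun h => hcr (Subtype.ext h)) j hj)

theorem HasGate.eq_of_laplacian_eq_zero [Fintype V] {G : WeightedDigraph V} {T : Set V} {r : T}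
    (hr : ∀ v : T, Relation.ReflTransGen (inducedDigraph G.toDigraph T).Adj r v)
    (hcl : ∀ v ∈ T, v ≠ r → ∀ u, G.Adj u v → u ∈ T) {l : V → ℝ}
    (hl : G.laplacian.mulVec l = 0) {v : V} (hv : v ∈ T) : l v = l r := by
  obtain ⟨a, haT, ha⟩ := Set.exists_max_image T l T.toFinite ⟨v, hv⟩
  obtain ⟨b, hbT, hb⟩ := Set.exists_min_image T l T.toFinite ⟨v, hv⟩
  have h1 := eq_of_forall_le hr hcl hl haT ha
  have h2 := eq_of_forall_le hr hcl (l := fun i => -l i)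
    (by rw [laplacian_mulVec_neg, hl, neg_zero]) hbT (fun u hu => neg_le_neg (hb u hu))
  exact le_antisymm (h1 ▸ ha v hv) (neg_injective h2 ▸ hb v hv)

theorem HasGate.convergesIdentically [Fintype V] {G : WeightedDigraph V} {T : Set V}
    (h : G.HasGate T) : G.ConvergesIdentically T := by
  intro H hH x hx
  obtain ⟨r, hr, hcl⟩ := h
  obtain ⟨l, hlim, hl⟩ := hx.exists_tendsto
  rw [← hH] at hr
  refine ⟨l r, fun i hi => ?_⟩
  rw [← eq_of_laplacian_eq_zero hr (hH ▸ hcl) hl hi]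
  exact hlim i

/-- A balanced function is an equilibrium for some choice of the weights. -/
theorem exists_laplacian_mulVec_eq_zero [Fintype V] (G : WeightedDigraph V) {h : V → ℝ}
    (hh : IsBalanced G.Adj h) :
    ∃ H : WeightedDigraph V, H.toDigraph = G.toDigraph ∧ H.laplacian.mulVec h = 0 := by
  classical
  let up : V → V → ℝ := fun i k => if G.Adj k i then max (h k - h i) 0 else 0
  let down : V → V → ℝ := fun i k => if G.Adj k i then max (h i - h k) 0 else 0
  -- Higher predecessors are weighted by the total downward gap and lower ones by the total upward
  -- gap, so the two pulls cancel. Balance makes these weights positive.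
  let w : V → V → ℝ := fun i j =>
    if G.Adj j i then
      if h i < h j then ∑ k, down i k else if h j < h i then ∑ k, up i k else 1
    else 0
  have hup : ∀ i k, 0 ≤ up i k := fun i k => by
    simp only [up]; split_ifs <;> simp
  have hdown : ∀ i k, 0 ≤ down i k := fun i k => by
    simp only [down]; split_ifs <;> simp
  have hpos : ∀ i j, G.Adj j i → 0 < w i j := by
    intro i j hij
    simp only [w, if_pos hij]
    split_ifs with h1 h2
    · rcases hh i with h3 | ⟨⟨k, hk, hlt⟩, -⟩
      · exact absurd (h3 j hij) h1.ne'
      · refine Finset.sum_pos' (fun k _ => hdown i k) ⟨k, Finset.mem_univ k, ?_⟩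
        simp [down, hk, hlt]
    · rcases hh i with h3 | ⟨-, ⟨k, hk, hlt⟩⟩
      · exact absurd (h3 j hij) h2.ne
      · refine Finset.sum_pos' (fun k _ => hup i k) ⟨k, Finset.mem_univ k, ?_⟩
        simp [up, hk, hlt]
    · exact one_pos
  have hzero : ∀ i j, ¬ G.Adj j i → w i j = 0 := fun i j hij => by simp [w, hij]
  let H : WeightedDigraph V :=
    { toDigraph := G.toDigraph
      loopless := G.loopless
      weight := Matrix.of w
      weight_nonneg := fun i j => by
        by_cases hij : G.Adj j i
        · exact (hpos i j hij).le
        · exact (hzero i j hij).ge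
      weight_pos_iff := fun i j => by
        refine ⟨fun hw => ?_, hpos i j⟩
        by_contra hij
        exact hw.ne' (hzero i j hij) }
  refine ⟨H, rfl, funext fun i => ?_⟩
  rw [laplacian_mulVec_apply]
  have hterm : ∀ k, w i k * (h i - h k) =
      (∑ k, up i k) * down i k - (∑ k, down i k) * up i k := by
    intro k
    by_cases hk : G.Adj k i
    · simp only [w, if_pos hk]
      rcases lt_trichotomy (h i) (h k) with hlt | heq | hlt
      · have h1 : down i k = 0 := by simp [down, hlt.le]
        have h2 : up i k = h k - h i := by simp [up, hk, hlt.le]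
        rw [if_pos hlt, h1, h2]
        ring
      · simp [up, down, heq]
      · have h1 : down i k = h i - h k := by simp [down, hk, hlt.le]
        have h2 : up i k = 0 := by simp [up, hlt.le]
        rw [if_neg hlt.not_gt, if_pos hlt, h1, h2]
        ring
    · simp [w, up, down, hk]
  calc ∑ k, w i k * (h i - h k)
      = ∑ k, ((∑ k, up i k) * down i k - (∑ k, down i k) * up i k) :=
        Finset.sum_congr rfl fun k _ => hterm k
    _ = 0 := by
        rw [Finset.sum_sub_distrib, ← Finset.mul_sum, ← Finset.mul_sum]
        ring

/-- The pairs of nodes at which `h` takes different values. -/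
def separatedPairs (h : V → ℝ) : Set (V × V) :=
  {p | h p.1 ≠ h p.2}

/-- A balanced function can be refined unless all its level sets have a gate. -/
theorem exists_isBalanced_separatedPairs_ssubset [Fintype V] (G : WeightedDigraph V) {h : V → ℝ}
    (hh : IsBalanced G.Adj h) (i₀ : V) (hgate : ¬ G.HasGate {i | h i = h i₀}) :
    ∃ h', IsBalanced G.Adj h' ∧ separatedPairs h ⊂ separatedPairs h' := by
  classical
  set C : Set V := {i | h i = h i₀} with hC
  -- Edges into nodes fed from outside `C` are dropped: balance of `h` puts such nodes strictly
  -- between two predecessors, which survives a small perturbation. A node that `E`-reaches all of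
  -- `C` would be a gate.
  let E : C → C → Prop := fun j i => G.Adj j i ∧ ∀ k, G.Adj k i → k ∈ C
  have : Nonempty C := ⟨⟨i₀, rfl⟩⟩
  obtain ⟨A, B, ⟨a, ha⟩, ⟨b, hb⟩, hA, hB, hAB⟩ : ∃ A B : Set C, A.Nonempty ∧ B.Nonempty ∧
      (∀ i ∈ A, ∀ j, E j i → j ∈ A) ∧ (∀ i ∈ B, ∀ j, E j i → j ∈ B) ∧ Disjoint A B := by
    by_contra! hno
    obtain ⟨r, hr⟩ := exists_forall_reflTransGen E hno
    refine hgate ⟨r, fun v => (hr v).lift id fun _ _ hab => hab.1, fun v hv hvr u hu => ?_⟩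
    rcases Relation.ReflTransGen.cases_tail (hr ⟨v, hv⟩) with heq | ⟨w, -, hw⟩
    · exact absurd (congrArg Subtype.val heq) hvr
    · exact hw.2 u hu
  obtain ⟨g₀, hg₀, hgA, hgB⟩ := exists_isBalanced_of_disjoint E hA hB hAB
  let g : V → ℝ := fun i => if hi : i ∈ C then g₀ ⟨i, hi⟩ else 0
  have hgC : ∀ i : C, g i = g₀ i := fun i => dif_pos i.2
  have hgn : ∀ i, i ∉ C → g i = 0 := fun i hi => dif_neg hi
  -- A small `δ` keeps every strict inequality of `h`, so no separated pair is lost.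
  obtain ⟨δ, hδ, hlt⟩ : ∃ δ : ℝ, 0 < δ ∧ ∀ i j, h i < h j → h i + δ * g i < h j + δ * g j := by
    have hev : ∀ᶠ δ : ℝ in 𝓝[>] 0, ∀ i j, h i < h j → h i + δ * g i < h j + δ * g j := by
      refine eventually_all.2 fun i => eventually_all.2 fun j => ?_
      by_cases hij : h i < h j
      · have ht : ∀ k, Tendsto (fun δ : ℝ => h k + δ * g k) (𝓝[>] 0) (𝓝 (h k)) := by
          intro k
          have : Continuous fun δ : ℝ => h k + δ * g k := by fun_prop
          simpa using (this.tendsto 0).mono_left nhdsWithin_le_nhds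
        filter_upwards [(ht i).eventually_lt (ht j) hij] with δ hδ _ using hδ
      · exact Eventually.of_forall fun δ h => absurd h hij
    obtain ⟨δ, h1, h2⟩ := (hev.and self_mem_nhdsWithin).exists
    exact ⟨δ, h2, h1⟩
  refine ⟨fun i => h i + δ * g i, fun i => ?_, ?_⟩
  · rcases hh i with heq | ⟨⟨j, hj, hji⟩, k, hk, hik⟩
    · by_cases hi : i ∈ C
      · have hpred : ∀ k, G.Adj k i → k ∈ C := fun k hk => (heq k hk).trans hi
        rcases hg₀ ⟨i, hi⟩ with h1 | ⟨⟨j, hj, hji⟩, k, hk, hik⟩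
        · refine Or.inl fun j hj => ?_
          have h2 := h1 ⟨j, hpred j hj⟩ ⟨hj, hpred⟩
          rw [← hgC, ← hgC] at h2
          simp only [heq j hj]
          rw [h2]
        · rw [← hgC, ← hgC] at hji hik
          refine Or.inr ⟨⟨j, hj.1, ?_⟩, k, hk.1, ?_⟩
          · simp only [heq j hj.1]
            exact add_lt_add_right (mul_lt_mul_of_pos_left hji hδ) _
          · simp only [heq k hk.1]
            exact add_lt_add_right (mul_lt_mul_of_pos_left hik hδ) _
      · refine Or.inl fun j hj => ?_
        have hj' : j ∉ C := fun h => hi ((heq j hj).symm.trans h)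
        simp only [heq j hj, hgn i hi, hgn j hj']
    · exact Or.inr ⟨⟨j, hj, hlt j i hji⟩, k, hk, hlt i k hik⟩
  · refine ⟨fun p hp => ?_, fun hsub => ?_⟩
    · rcases lt_or_gt_of_ne hp with h1 | h1
      · exact (hlt _ _ h1).ne
      · exact (hlt _ _ h1).ne'
    · have hab : ((a : V), (b : V)) ∈ separatedPairs h := by
        refine hsub ?_
        have h1 : h a = h b := Eq.trans a.2 (Eq.symm b.2)
        simp [separatedPairs, hgC, hgA a ha, hgB b hb, h1, hδ.ne']
      exact hab (Eq.trans a.2 (Eq.symm b.2))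

theorem ConvergesIdentically.exists_hasGate [Fintype V] [Nonempty V] {G : WeightedDigraph V}
    {S : Set V} (hS : G.ConvergesIdentically S) : ∃ T, S ⊆ T ∧ G.HasGate T := by
  obtain ⟨_, ⟨h, hh, rfl⟩, hmax⟩ :=
    (Set.toFinite (separatedPairs '' {h : V → ℝ | IsBalanced G.Adj h})).exists_maximal
      ⟨_, fun _ => 0, fun _ => Or.inl fun _ _ => rfl, rfl⟩
  have hgate : ∀ i₀, G.HasGate {i | h i = h i₀} := by
    intro i₀
    by_contra hno
    obtain ⟨h', hh', hss⟩ := G.exists_isBalanced_separatedPairs_ssubset hh i₀ hno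
    exact hss.2 (hmax ⟨h', hh', rfl⟩ hss.1)
  obtain ⟨H, hH, hl⟩ := G.exists_laplacian_mulVec_eq_zero hh
  obtain ⟨c, hc⟩ := hS H hH _ (isTrajectory_const hl)
  have hval : ∀ i ∈ S, h i = c := fun i hi => tendsto_nhds_unique tendsto_const_nhds (hc i hi)
  -- The empty set has no gate; any level set serves for it, as `V` is nonempty.
  rcases S.eq_empty_or_nonempty with rfl | ⟨i₀, hi₀⟩
  · exact ⟨_, Set.empty_subset _, hgate (Classical.arbitrary V)⟩
  · exact ⟨_, fun i hi => (hval i hi).trans (hval i₀ hi₀).symm, hgate i₀⟩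

end WeightedDigraph

theorem theorem1 {V : Type*} [Fintype V] [Nonempty V] (G : WeightedDigraph V) (S : Set V) :
    G.IsTopologicalCluster S ↔
      Maximal (fun T : Set V => G.CondC1 T ∧ G.CondC2 T) S := by
  simp only [WeightedDigraph.IsTopologicalCluster, G.condC1_and_condC2_iff]
  constructor
  · intro h
    obtain ⟨T, hST, hT⟩ := h.prop.exists_hasGate
    have heq : S = T := hST.antisymm (h.le_of_ge hT.convergesIdentically hST)
    exact ⟨heq ▸ hT, fun T' hT' hle => h.le_of_ge hT'.convergesIdentically hle⟩
  · intro h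
    refine ⟨h.prop.convergesIdentically, fun T' hT' hle => ?_⟩
    obtain ⟨T, hsub, hT⟩ := WeightedDigraph.ConvergesIdentically.exists_hasGate hT'
    exact hsub.trans (h.le_of_ge hT (hle.trans hsub))
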